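/- Let $r\ge 2$. An ordered $r$-matching is a set of pairwise disjoint $r$-element subsets (edges) of a linearly ordered set, with no isolated vertices; its size is the number of its edges. An interval coloring of an ordered $r$-matching $M$ is a partition of its vertex set into intervals such that every edge has at most one vertex in each interval, and $M$ is $r$-partite if the least number of intervals in an interval coloring of $M$ equals $r$. An $r$-pattern is an ordered $r$-matching of size $2$ (up to order-isomorphism), and $\mathcal{R}^{(r)}$ is the set of all $r$-partite $r$-patterns. An $\mathcal{R}^{(r)}$-clique is an ordered $r$-matching in which every pair of edges is order-isomorphic to a member of $\mathcal{R}^{(r)}$, and $z_{\mathcal{R}^{(r)}}(M)$ is the maximum size of an $\mathcal{R}^{(r)}$-clique contained in $M$. Let $\mathbb{RM}^{(r)}_n$ be chosen uniformly at random among all ordered $r$-matchings of size $n$ with vertex set $[rn]=\{1,\dots,rn\}$. For random variables $X_n$ write $X_n\sim a_n$ if $X_n/a_n\to 1$ in probability as $n\to\infty$. Then \[ z_{\mathcal{R}^{(r)}}(\mathbb{RM}^{(r)}_n)\sim\frac{(r-1)!}{r^{r-1}}\,n . \] Moreover, for every $n\ge1$, every ordered $r$-matching $M$ of size $n$ on $[rn]$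 has a largest $r$-partite sub-matching, and its size equals $z_{\mathcal{R}^{(r)}}(M)$. Consequently, if $R^{(r)}_n$ is a largest $r$-partite sub-matching of $\mathbb{RM}^{(r)}_n$ (with ties broken in any way, for instance lexicographically), then \[ |R^{(r)}_n|\sim\frac{(r-1)!}{r^{r-1}}\,n . \] -/

import Mathlib

open Filter Topology

namespace OrderedMatching

/-- The vertex set of a hypergraph without isolated vertices, given by its set of edges. -/
def vertexSet {V : Type*} [LinearOrder V] (M : Finset (Finset V)) : Finset V :=
  M.biUnion id

/-- `M` is an ordered `r`-matching: a set of pairwise disjoint `r`-element subsets of a linearly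
ordered set. -/
def IsMatching {V : Type*} [LinearOrder V] (r : ℕ) (M : Finset (Finset V)) : Prop :=
  (∀ e ∈ M, e.card = r) ∧ ∀ e ∈ M, ∀ f ∈ M, e ≠ f → Disjoint e f

/-- Two ordered hypergraphs without isolated vertices are order-isomorphic: some order isomorphism
of their vertex sets carries edges to edges, in both directions. -/
def OrderIsomorphic {V W : Type*} [LinearOrder V] [LinearOrder W]
    (M : Finset (Finset V)) (N : Finset (Finset W)) : Prop :=
  ∃ φ : {x // x ∈ vertexSet M} ≃o {y // y ∈ vertexSet N},
    ∀ e : Finset {x // x ∈ vertexSet M},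
      e.map (Function.Embedding.subtype _) ∈ M ↔
        (e.map φ.toEquiv.toEmbedding).map (Function.Embedding.subtype _) ∈ N

/-- An interval coloring: a partition of the vertex set into intervals (of the vertex set) such
that each edge has at most one vertex in each interval. -/
def IsIntervalColoring {V : Type*} [LinearOrder V] (M : Finset (Finset V))
    (C : Finpartition (vertexSet M)) : Prop :=
  (∀ I ∈ C.parts, ∀ x ∈ I, ∀ z ∈ I, ∀ y ∈ vertexSet M, x ≤ y → y ≤ z → y ∈ I) ∧
    ∀ e ∈ M, ∀ I ∈ C.parts, (e ∩ I).card ≤ 1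

/-- The interval chromatic number: the least number of intervals in an interval coloring
(the partition into singletons is always one, so the set below is never empty). -/
noncomputable def intervalChromaticNumber {V : Type*} [LinearOrder V]
    (M : Finset (Finset V)) : ℕ :=
  sInf {k | ∃ C : Finpartition (vertexSet M), IsIntervalColoring M C ∧ C.parts.card = k}

/-- An `r`-partite ordered `r`-matching. -/
def IsRPartite {V : Type*} [LinearOrder V] (r : ℕ) (M : Finset (Finset V)) : Prop :=
  IsMatching r M ∧ intervalChromaticNumber M = r

open Classical in
/-- All ordered `r`-matchings of size `n` on the vertex set `[rn]`. -/
noncomputable def matchings (r n : ℕ) : Finset (Finset (Finset (Fin (r * n)))) :=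
  Finset.univ.filter fun M => IsMatching r M ∧ M.card = n ∧ vertexSet M = Finset.univ

open Classical in
/-- The set of all `r`-partite `r`-patterns, where an `r`-pattern is an ordered `r`-matching of
size two. -/
noncomputable def rPartitePatterns (r : ℕ) : Finset (Finset (Finset (Fin (r * 2)))) :=
  (matchings r 2).filter fun P => IsRPartite r P

/-- The `r`-matching `M` is a clique for the set `Pats` of `r`-patterns: every pair of edges
of `M` forms a pattern
belonging to `Pats`. -/
def IsClique {V : Type*} [LinearOrder V] {r : ℕ} (Pats : Finset (Finset (Finset (Fin (r * 2)))))
    (M : Finset (Finset V)) : Prop :=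
  IsMatching r M ∧ ∀ e ∈ M, ∀ f ∈ M, e ≠ f → ∃ P ∈ Pats, OrderIsomorphic {e, f} P

open Classical in
/-- The maximum size of a clique for `Pats` contained in the matching `M`. -/
noncomputable def maxClique {V : Type*} [LinearOrder V] {r : ℕ}
    (Pats : Finset (Finset (Finset (Fin (r * 2))))) (M : Finset (Finset V)) : ℕ :=
  (M.powerset.filter fun N => IsClique Pats N).sup Finset.card

/-- `N` is an `r`-partite sub-matching of `M` of the largest size. -/
def IsLargestRPartite {V : Type*} [LinearOrder V] (r : ℕ) (M N : Finset (Finset V)) : Prop :=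
  N ⊆ M ∧ IsRPartite r N ∧ ∀ N' ⊆ M, IsRPartite r N' → N'.card ≤ N.card

open Classical in
/-- The probability that an ordered `r`-matching chosen uniformly at random among all ordered
`r`-matchings of size `n` on `[rn]` has the property `p`. -/
noncomputable def probRM (r n : ℕ) (p : Finset (Finset (Fin (r * n))) → Prop) : ℝ :=
  ((matchings r n).filter p).card / (matchings r n).card

/-- `X n ∼ a n` for random variables `X n` of the random ordered `r`-matching of size `n`:
the quotient `X n / a n` converges to `1` in probability as `n → ∞`. -/
def AsympInProb (r : ℕ) (X : ∀ n : ℕ, Finset (Finset (Fin (r * n))) → ℝ) (a : ℕ → ℝ) : Prop :=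
  ∀ ε : ℝ, 0 < ε →
    Tendsto (fun n => probRM r n fun M => |X n M / a n - 1| < ε) atTop (𝓝 1)

end OrderedMatching

/-! A nonempty matching is `r`-partite iff it has a monotone coloring by `r` colors that is
injective on every edge, and such a coloring exists as soon as it exists for each pair of edges
(`IsClique.exists_monotone_coloring`). Hence the largest clique and the largest `r`-partite
sub-matching have the same size: the maximum, over monotone colorings `c`, of the number of edges of
`M` that are rainbow for `c`.

For fixed `c`, the number of rainbow `r`-sets is the product of the class sizes, at most `n ^ r` by
AM-GM, with equality for `r` blocks of length `n`. Each `r`-set is an edge of the random matching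
with probability `n / (r * n).choose r`, so the expected number of rainbow edges is at most `n * n ^
r / (r * n).choose r`, which is asymptotic to the claimed value. A second moment bound, uniform in
the family of `r`-sets, gives concentration (`probRM_deviation_le`).

Chebyshev's inequality is too weak for a union bound over all monotone colorings. These are
therefore replaced by colorings constant on blocks of length about `n / K`: their number does not
depend on `n`, and the replacement loses only about `r * n / K` edges (`exists_maxClique_le`). -/

namespace OrderedMatching

/-! ### Interval colorings as monotone colorings -/

section Coloring

variable {V W : Type*} [LinearOrder V] [LinearOrder W]

/-- A monotone coloring of the vertices by `0, …, k - 1` that is injective on every edge. -/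
def HasColoring (k : ℕ) (M : Finset (Finset V)) : Prop :=
  ∃ c : V → ℕ, MonotoneOn c (vertexSet M) ∧ (∀ v ∈ vertexSet M, c v < k) ∧
    ∀ e ∈ M, Set.InjOn c e

theorem mem_vertexSet {M : Finset (Finset V)} {v : V} :
    v ∈ vertexSet M ↔ ∃ e ∈ M, v ∈ e := by
  simp [vertexSet]

theorem subset_vertexSet {M : Finset (Finset V)} {e : Finset V} (he : e ∈ M) :
    e ⊆ vertexSet M := fun _ hv => mem_vertexSet.2 ⟨e, he, hv⟩

theorem vertexSet_mono {M N : Finset (Finset V)} (h : N ⊆ M) : vertexSet N ⊆ vertexSet M :=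
  Finset.biUnion_subset_biUnion_of_subset_left _ h

theorem HasColoring.mono {k : ℕ} {M N : Finset (Finset V)} (hM : HasColoring k M) (h : N ⊆ M) :
    HasColoring k N := by
  obtain ⟨c, hc, hk, hi⟩ := hM
  exact ⟨c, hc.mono (Finset.coe_subset.2 (vertexSet_mono h)),
    fun v hv => hk v (vertexSet_mono h hv), fun e he => hi e (h he)⟩

theorem IsMatching.mono {r : ℕ} {M N : Finset (Finset V)} (hM : IsMatching r M) (h : N ⊆ M) :
    IsMatching r N :=
  ⟨fun e he => hM.1 e (h he), fun e he f hf => hM.2 e (h he) f (h hf)⟩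

/-- The color of `v` counts the parts lying entirely to the left of `v`. For `v < w` in one edge,
the part of `v` is counted for `w` but not for `v`: otherwise convexity would put `w` in that part
as well. -/
theorem IsIntervalColoring.hasColoring {M : Finset (Finset V)} {C : Finpartition (vertexSet M)}
    (hC : IsIntervalColoring M C) : HasColoring C.parts.card M := by
  classical
  have hsub : ∀ {v w : V}, v ≤ w →
      (C.parts.filter fun I => ∀ x ∈ I, x < v) ⊆ C.parts.filter fun I => ∀ x ∈ I, x < w := by
    intro v w hvw I hI
    rw [Finset.mem_filter] at hI ⊢
    exact ⟨hI.1, fun x hx => (hI.2 x hx).trans_le hvw⟩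
  refine ⟨fun v => (C.parts.filter fun I => ∀ x ∈ I, x < v).card,
    fun v _ w _ hvw => Finset.card_le_card (hsub hvw), fun v hv => ?_, fun e he => ?_⟩
  · obtain ⟨I, hI, hvI⟩ := C.exists_mem hv
    refine Finset.card_lt_card ⟨Finset.filter_subset _ _, fun h => ?_⟩
    exact lt_irrefl v ((Finset.mem_filter.1 (h hI)).2 v hvI)
  · have key : ∀ v ∈ e, ∀ w ∈ e, v < w →
        (C.parts.filter fun I => ∀ x ∈ I, x < v).card <
          (C.parts.filter fun I => ∀ x ∈ I, x < w).card := by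
      intro v hv w hw hvw
      obtain ⟨I, hI, hvI⟩ := C.exists_mem (subset_vertexSet he hv)
      refine Finset.card_lt_card ⟨hsub hvw.le, fun h => ?_⟩
      have hIw : I ∈ C.parts.filter fun I => ∀ x ∈ I, x < w := by
        refine Finset.mem_filter.2 ⟨hI, fun x hx => ?_⟩
        by_contra! hxw
        have hwI := hC.1 I hI v hvI x hx w (subset_vertexSet he hw) hvw.le hxw
        exact hvw.ne (Finset.card_le_one.1 (hC.2 e he I hI) v (Finset.mem_inter.2 ⟨hv, hvI⟩) w
          (Finset.mem_inter.2 ⟨hw, hwI⟩))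
      exact lt_irrefl v ((Finset.mem_filter.1 (h hIw)).2 v hvI)
    intro v hv w hw hvw
    rcases lt_trichotomy v w with h | h | h
    · exact absurd hvw (key v hv w hw h).ne
    · exact h
    · exact absurd hvw (key w hw v hv h).ne'

/-- The parts are the nonempty color classes. Unused colors give no part, hence only an inequality.
-/
theorem HasColoring.exists_isIntervalColoring {k : ℕ} {M : Finset (Finset V)}
    (hM : HasColoring k M) :
    ∃ C : Finpartition (vertexSet M), IsIntervalColoring M C ∧ C.parts.card ≤ k := by
  classical
  obtain ⟨c, hc, hk, hi⟩ := hM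
  have hu : ∀ a ∈ vertexSet M, ∃! t ∈ ((vertexSet M).image c).image
      fun i => (vertexSet M).filter fun v => c v = i, a ∈ t := by
    intro a ha
    refine ⟨(vertexSet M).filter fun v => c v = c a, ⟨Finset.mem_image.2
      ⟨c a, Finset.mem_image_of_mem c ha, rfl⟩, by simp [ha]⟩, ?_⟩
    rintro t ⟨ht, hat⟩
    obtain ⟨i, -, rfl⟩ := Finset.mem_image.1 ht
    rw [(Finset.mem_filter.1 hat).2]
  refine ⟨Finpartition.ofExistsUnique (((vertexSet M).image c).image
      fun i => (vertexSet M).filter fun v => c v = i) ?_ hu ?_, ⟨?_, ?_⟩, ?_⟩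
  · intro p hp
    obtain ⟨i, -, rfl⟩ := Finset.mem_image.1 hp
    exact Finset.filter_subset _ _
  · intro h
    obtain ⟨i, hi, h⟩ := Finset.mem_image.1 h
    obtain ⟨v, hv, rfl⟩ := Finset.mem_image.1 hi
    have : v ∈ (vertexSet M).filter fun w => c w = c v := by simp [hv]
    rw [h] at this
    simp at this
  · intro I hI x hx z hz y hy hxy hyz
    obtain ⟨i, -, rfl⟩ := Finset.mem_image.1 hI
    rw [Finset.mem_filter] at hx hz ⊢
    refine ⟨hy, le_antisymm ?_ ?_⟩
    · exact hz.2 ▸ hc hy hz.1 hyz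
    · exact hx.2 ▸ hc hx.1 hy hxy
  · intro e he I hI
    obtain ⟨i, -, rfl⟩ := Finset.mem_image.1 hI
    refine Finset.card_le_one.2 fun a ha b hb => ?_
    simp only [Finset.mem_inter, Finset.mem_filter] at ha hb
    exact hi e he ha.1 hb.1 (ha.2.2.trans hb.2.2.symm)
  · refine Finset.card_image_le.trans ?_
    calc ((vertexSet M).image c).card ≤ (Finset.range k).card :=
          Finset.card_le_card fun i hi => by
            obtain ⟨v, hv, rfl⟩ := Finset.mem_image.1 hi
            exact Finset.mem_range.2 (hk v hv)
      _ = k := Finset.card_range k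

theorem HasColoring.le {k r : ℕ} {M : Finset (Finset V)} (h : HasColoring k M)
    (hM : IsMatching r M) (hne : M.Nonempty) : r ≤ k := by
  obtain ⟨c, -, hk, hi⟩ := h
  obtain ⟨e, he⟩ := hne
  calc r = (e.image c).card := by rw [Finset.card_image_of_injOn (hi e he), hM.1 e he]
    _ ≤ (Finset.range k).card := Finset.card_le_card fun i hi => by
        obtain ⟨v, hv, rfl⟩ := Finset.mem_image.1 hi
        exact Finset.mem_range.2 (hk v (subset_vertexSet he hv))
    _ = k := Finset.card_range k

theorem IsIntervalColoring.intervalChromaticNumber_le {M : Finset (Finset V)}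
    {C : Finpartition (vertexSet M)} (hC : IsIntervalColoring M C) :
    intervalChromaticNumber M ≤ C.parts.card := by
  unfold intervalChromaticNumber
  exact Nat.sInf_le ⟨C, hC, rfl⟩

theorem IsRPartite.hasColoring {r : ℕ} {M : Finset (Finset V)} (hM : IsRPartite r M)
    (hr : r ≠ 0) : HasColoring r M := by
  have h : intervalChromaticNumber M ∈ {k | ∃ C : Finpartition (vertexSet M),
      IsIntervalColoring M C ∧ C.parts.card = k} := by
    apply Nat.sInf_mem
    rw [Set.nonempty_iff_ne_empty]
    intro h
    -- The infimum of the empty set is `0` by convention, which `r ≠ 0` excludes.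
    exact hr (hM.2.symm.trans (by rw [intervalChromaticNumber, h, Nat.sInf_empty]))
  obtain ⟨C, hC, hk⟩ := h
  rw [hM.2] at hk
  exact hk ▸ hC.hasColoring

theorem HasColoring.isRPartite {r : ℕ} {M : Finset (Finset V)} (h : HasColoring r M)
    (hM : IsMatching r M) (hne : M.Nonempty) : IsRPartite r M := by
  refine ⟨hM, le_antisymm ?_ ?_⟩
  · obtain ⟨C, hC, hk⟩ := h.exists_isIntervalColoring
    exact hC.intervalChromaticNumber_le.trans hk
  · refine le_csInf ?_ ?_
    · obtain ⟨C, hC, -⟩ := h.exists_isIntervalColoring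
      exact ⟨_, C, hC, rfl⟩
    · rintro k ⟨C, hC, rfl⟩
      exact hC.hasColoring.le hM hne

/-- The empty matching needs no intervals at all; this is why nonemptiness enters the
characterizations below. -/
theorem not_isRPartite_empty {r : ℕ} (hr : r ≠ 0) : ¬ IsRPartite r (∅ : Finset (Finset V)) := by
  intro h
  have h0 : HasColoring 0 (∅ : Finset (Finset V)) := ⟨fun _ => 0, by simp [vertexSet, MonotoneOn]⟩
  obtain ⟨C, hC, hk⟩ := h0.exists_isIntervalColoring
  exact hr (h.2 ▸ Nat.eq_zero_of_le_zero (hC.intervalChromaticNumber_le.trans hk))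

theorem isRPartite_iff {r : ℕ} (hr : r ≠ 0) {M : Finset (Finset V)} :
    IsRPartite r M ↔ IsMatching r M ∧ M.Nonempty ∧ HasColoring r M :=
  ⟨fun h => ⟨h.1, Finset.nonempty_iff_ne_empty.2 fun h0 => not_isRPartite_empty hr (h0 ▸ h),
    h.hasColoring hr⟩, fun h => h.2.2.isRPartite h.1 h.2.1⟩

theorem HasColoring.of_orderIsomorphic {k : ℕ} {M : Finset (Finset V)} {N : Finset (Finset W)}
    (hN : HasColoring k N) (h : OrderIsomorphic M N) : HasColoring k M := by
  classical
  obtain ⟨φ, hφ⟩ := h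
  obtain ⟨c, hc, hk, hi⟩ := hN
  have hval : ∀ v (hv : v ∈ vertexSet M), (fun v => if h : v ∈ vertexSet M then
      c (φ ⟨v, h⟩) else 0) v = c (φ ⟨v, hv⟩) := fun v hv => dif_pos hv
  refine ⟨fun v => if h : v ∈ vertexSet M then c (φ ⟨v, h⟩) else 0, ?_, ?_, ?_⟩
  · intro v hv w hw hvw
    rw [hval v hv, hval w hw]
    exact hc (φ ⟨v, hv⟩).2 (φ ⟨w, hw⟩).2 (φ.monotone hvw)
  · intro v hv
    exact (hval v hv).trans_lt (hk _ (φ ⟨v, hv⟩).2)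
  · intro e he
    have hes : (e.subtype (· ∈ vertexSet M)).map (Function.Embedding.subtype _) = e :=
      Finset.subtype_map_of_mem fun x hx => subset_vertexSet he hx
    have heN := (hφ (e.subtype (· ∈ vertexSet M))).1 (by rw [hes]; exact he)
    have hmem : ∀ v (hv : v ∈ vertexSet M), v ∈ e → (φ ⟨v, hv⟩ : W) ∈
        ((e.subtype (· ∈ vertexSet M)).map φ.toEquiv.toEmbedding).map
          (Function.Embedding.subtype _) := by
      intro v hv hve
      refine Finset.mem_map_of_mem (Function.Embedding.subtype _) (a := φ ⟨v, hv⟩) ?_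
      exact Finset.mem_map_of_mem φ.toEquiv.toEmbedding (a := (⟨v, hv⟩ : {x // x ∈ vertexSet M}))
        (Finset.mem_subtype.2 hve)
    intro v hv w hw hvw
    have hv' := subset_vertexSet he hv
    have hw' := subset_vertexSet he hw
    rw [hval v hv', hval w hw'] at hvw
    have := hi _ heN (hmem v hv' hv) (hmem w hw' hw) hvw
    simpa using φ.injective (Subtype.ext this)

theorem OrderIsomorphic.symm {M : Finset (Finset V)} {N : Finset (Finset W)}
    (h : OrderIsomorphic M N) : OrderIsomorphic N M := by
  obtain ⟨φ, hφ⟩ := h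
  refine ⟨φ.symm, fun e => ?_⟩
  rw [hφ (e.map φ.symm.toEquiv.toEmbedding)]
  have : (e.map φ.symm.toEquiv.toEmbedding).map φ.toEquiv.toEmbedding = e := by
    ext x
    simp
  rw [this]

end Coloring

/-! ### Cliques of `r`-partite patterns are `r`-partite -/

section Clique

variable {V : Type*} [LinearOrder V]

theorem IsMatching.card_vertexSet {r : ℕ} {M : Finset (Finset V)} (hM : IsMatching r M) :
    (vertexSet M).card = r * M.card := by
  rw [vertexSet, Finset.card_biUnion (t := id) fun e he f hf hef => hM.2 e he f hf hef,
    Finset.sum_congr rfl fun e he => show (id e).card = r from hM.1 e he,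
    Finset.sum_const, smul_eq_mul, mul_comm]

/-- Every ordered matching is order-isomorphic to one on an initial segment of `ℕ`. -/
theorem IsMatching.exists_orderIsomorphic {r n : ℕ} {M : Finset (Finset V)}
    (hM : IsMatching r M) (hn : M.card = n) : ∃ P ∈ matchings r n, OrderIsomorphic M P := by
  classical
  have hcard : (vertexSet M).card = r * n := hn ▸ hM.card_vertexSet
  let ψ := (vertexSet M).orderIsoOfFin hcard
  let ι : Fin (r * n) ↪ V := ψ.toEquiv.toEmbedding.trans (Function.Embedding.subtype _)
  have hι : ∀ v ∈ vertexSet M, ∃ x, ι x = v := fun v hv =>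
    ⟨ψ.symm ⟨v, hv⟩, by simp [ι]⟩
  let P : Finset (Finset (Fin (r * n))) := Finset.univ.filter fun e => e.map ι ∈ M
  have hP : ∀ e, e ∈ P ↔ e.map ι ∈ M := fun e => by simp [P]
  have hsurj : ∀ e ∈ M, ∃ e' ∈ P, e'.map ι = e := by
    intro e he
    have h : (Finset.univ.filter fun x => ι x ∈ e).map ι = e := by
      ext v
      simp only [Finset.mem_map, Finset.mem_filter, Finset.mem_univ, true_and]
      constructor
      · rintro ⟨x, hx, rfl⟩
        exact hx
      · intro hv
        obtain ⟨x, rfl⟩ := hι v (subset_vertexSet he hv)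
        exact ⟨x, hv, rfl⟩
    exact ⟨_, (hP _).2 (h.symm ▸ he), h⟩
  have hv : ∀ x, x ∈ vertexSet P := by
    intro x
    obtain ⟨e, he, hx⟩ := mem_vertexSet.1 (ψ x).2
    obtain ⟨e', he', rfl⟩ := hsurj e he
    exact mem_vertexSet.2 ⟨e', he', (Finset.mem_map' ι).1 hx⟩
  refine ⟨P, ?_, OrderIsomorphic.symm ?_⟩
  · rw [matchings, Finset.mem_filter]
    refine ⟨Finset.mem_univ _, ⟨fun e he => ?_, fun e he f hf hef => ?_⟩, ?_, ?_⟩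
    · exact (Finset.card_map ι).symm.trans (hM.1 _ ((hP e).1 he))
    · exact (Finset.disjoint_map ι).1 (hM.2 _ ((hP e).1 he) _ ((hP f).1 hf)
        fun h => hef (Finset.map_injective ι h))
    · refine Eq.trans ?_ hn
      refine Finset.card_bij (fun e _ => e.map ι) (fun e he => (hP e).1 he)
        (fun e _ f _ h => Finset.map_injective ι h) fun e he => ?_
      obtain ⟨e', he', h⟩ := hsurj e he
      exact ⟨e', he', h⟩
    · exact Finset.eq_univ_of_forall hv
  · refine ⟨(⟨⟨Subtype.val, fun x => ⟨x, hv x⟩, fun _ => rfl, fun _ => rfl⟩, Iff.rfl⟩ :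
      {x // x ∈ vertexSet P} ≃o Fin (r * n)).trans ψ, fun e => ?_⟩
    rw [hP, Finset.map_map, Finset.map_map]
    rfl

/-- Consecutive intervals of length `r` form a matching. Needed to divide by the number of
matchings. -/
theorem matchings_nonempty {r : ℕ} (hr : r ≠ 0) (n : ℕ) : (matchings r n).Nonempty := by
  have hinj : Function.Injective fun i : ℕ => Finset.Ico (i * r) (i * r + r) := by
    intro i j hij
    have hi := Finset.left_mem_Ico.2 (show i * r < i * r + r by omega)
    have hj := Finset.left_mem_Ico.2 (show j * r < j * r + r by omega)
    have hi' := Finset.mem_Ico.1 ((congrArg (i * r ∈ ·) hij).mp hi)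
    have hj' := Finset.mem_Ico.1 ((congrArg (j * r ∈ ·) hij).mpr hj)
    exact Nat.eq_of_mul_eq_mul_right (Nat.pos_of_ne_zero hr) (le_antisymm hj'.1 hi'.1)
  have hM : IsMatching r ((Finset.range n).map ⟨_, hinj⟩) := by
    refine ⟨fun e he => ?_, fun e he f hf hef => ?_⟩
    · obtain ⟨i, -, rfl⟩ := Finset.mem_map.1 he
      simp
    · obtain ⟨i, -, rfl⟩ := Finset.mem_map.1 he
      obtain ⟨j, -, rfl⟩ := Finset.mem_map.1 hf
      refine Finset.disjoint_left.2 fun x hx hx' => hef ?_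
      simp only [Function.Embedding.coeFn_mk, Finset.mem_Ico] at hx hx' ⊢
      have hij : i = j := by
        rcases lt_trichotomy i j with h | h | h
        · have := Nat.mul_le_mul_right r (Nat.succ_le_of_lt h)
          rw [Nat.succ_mul] at this
          omega
        · exact h
        · have := Nat.mul_le_mul_right r (Nat.succ_le_of_lt h)
          rw [Nat.succ_mul] at this
          omega
      rw [hij]
  obtain ⟨P, hP, -⟩ := hM.exists_orderIsomorphic (n := n) (by simp)
  exact ⟨P, hP⟩

theorem IsMatching.isClique_of_hasColoring {r : ℕ} (hr : r ≠ 0) {M : Finset (Finset V)}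
    (hM : IsMatching r M) (h : HasColoring r M) : IsClique (rPartitePatterns r) M := by
  classical
  refine ⟨hM, fun e he f hf hef => ?_⟩
  have hsub : {e, f} ⊆ M := by
    intro x hx
    rcases Finset.mem_insert.1 hx with rfl | hx
    · exact he
    · exact Finset.mem_singleton.1 hx ▸ hf
  obtain ⟨P, hP, hiso⟩ := (hM.mono hsub).exists_orderIsomorphic (Finset.card_pair hef)
  refine ⟨P, ?_, hiso⟩
  rw [rPartitePatterns, Finset.mem_filter]
  refine ⟨hP, (isRPartite_iff hr).2 ?_⟩
  rw [matchings, Finset.mem_filter] at hP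
  exact ⟨hP.2.1, Finset.card_pos.1 (by omega), (h.mono hsub).of_orderIsomorphic hiso.symm⟩

/-- In a colored matching, the vertices of one edge up to a vertex `v` of another one are
at most as many as those of the edge of `v`. -/
theorem card_filter_le_of_coloring {r : ℕ} {c : V → ℕ} {e f : Finset V} {v : V}
    (hf : f.card = r) (hce : Set.InjOn c e) (hcf : Set.InjOn c f) (hv : v ∈ f)
    (hk : ∀ w ∈ f, c w < r) (hmono : MonotoneOn c ((e ∪ f : Finset V) : Set V)) :
    (e.filter (· ≤ v)).card ≤ (f.filter (· ≤ v)).card := by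
  -- Having `r` vertices, `f` uses all `r` colors, so exactly `c v + 1` of its vertices are at most
  -- `v`; for `e` this is only an upper bound.
  have himage : f.image c = Finset.range r := by
    refine Finset.eq_of_subset_of_card_le (fun i hi => ?_) ?_
    · obtain ⟨w, hw, rfl⟩ := Finset.mem_image.1 hi
      exact Finset.mem_range.2 (hk w hw)
    · rw [Finset.card_image_of_injOn hcf, hf, Finset.card_range]
  calc (e.filter (· ≤ v)).card = ((e.filter (· ≤ v)).image c).card :=
        (Finset.card_image_of_injOn (hce.mono (Finset.coe_subset.2 (Finset.filter_subset _ _)))).symm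
    _ ≤ (Finset.range (c v + 1)).card := Finset.card_le_card fun i hi => by
        obtain ⟨w, hw, rfl⟩ := Finset.mem_image.1 hi
        rw [Finset.mem_filter] at hw
        exact Finset.mem_range.2 (Nat.lt_succ_of_le
          (hmono (Finset.mem_union_left _ hw.1) (Finset.mem_union_right _ hv) hw.2))
    _ ≤ ((f.filter (· ≤ v)).image c).card := Finset.card_le_card fun i hi => by
        have hiv : i ≤ c v := Nat.le_of_lt_succ (Finset.mem_range.1 hi)
        have hir : i ∈ f.image c := himage ▸ Finset.mem_range.2 (hiv.trans_lt (hk v hv))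
        obtain ⟨w, hw, rfl⟩ := Finset.mem_image.1 hir
        refine Finset.mem_image.2 ⟨w, Finset.mem_filter.2 ⟨hw, ?_⟩, rfl⟩
        by_contra! hvw
        exact hvw.ne (hcf hv hw (le_antisymm
          (hmono (Finset.mem_union_right _ hv) (Finset.mem_union_right _ hw) hvw.le) hiv))
    _ ≤ (f.filter (· ≤ v)).card := Finset.card_image_le

/-- Pairwise colorings need not agree, but the rank of a vertex in its own edge does not depend on
them. By the pairwise condition this rank is the maximum, over all edges, of the number of vertices
at most `v`; that maximum is monotone in `v` on the whole line. -/
theorem IsClique.exists_monotone_coloring {r : ℕ} (hr : r ≠ 0) {M : Finset (Finset V)}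
    (hM : IsClique (rPartitePatterns r) M) :
    ∃ c : V → ℕ, Monotone c ∧ (∀ v, c v < r) ∧ ∀ e ∈ M, Set.InjOn c e := by
  classical
  have key : ∀ f ∈ M, ∀ v ∈ f,
      (M.sup fun e => (e.filter (· ≤ v)).card) = (f.filter (· ≤ v)).card := by
    intro f hf v hv
    refine le_antisymm (Finset.sup_le fun e he => ?_)
      (Finset.le_sup (f := fun e : Finset V => (e.filter (· ≤ v)).card) hf)
    rcases eq_or_ne e f with rfl | hef
    · exact le_rfl
    obtain ⟨P, hP, hiso⟩ := hM.2 e he f hf hef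
    rw [rPartitePatterns, Finset.mem_filter] at hP
    obtain ⟨c, hc, hk, hi⟩ := (hP.2.hasColoring hr).of_orderIsomorphic hiso
    have he' : e ∈ ({e, f} : Finset (Finset V)) := by simp
    have hf' : f ∈ ({e, f} : Finset (Finset V)) := by simp
    refine card_filter_le_of_coloring (hM.1.1 f hf) (hi e he') (hi f hf') hv
      (fun w hw => hk w (subset_vertexSet hf' hw)) (hc.mono ?_)
    exact Finset.coe_subset.2 (Finset.union_subset (subset_vertexSet he') (subset_vertexSet hf'))
  -- Ranks start at `1`, colors at `0`. On vertices of edges the rank is positive, so truncation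
  -- does not harm injectivity.
  refine ⟨fun v => (M.sup fun e => (e.filter (· ≤ v)).card) - 1, fun v w hvw => ?_, fun v => ?_,
    fun f hf v hv w hw hvw => ?_⟩
  · refine Nat.sub_le_sub_right (Finset.sup_mono_fun fun e _ => Finset.card_le_card fun x hx => ?_) 1
    rw [Finset.mem_filter] at hx ⊢
    exact ⟨hx.1, hx.2.trans hvw⟩
  · have : (M.sup fun e => (e.filter (· ≤ v)).card) ≤ r := Finset.sup_le fun e he =>
      (Finset.card_filter_le _ _).trans (hM.1.1 e he).le
    have hr' := Nat.pos_of_ne_zero hr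
    change (M.sup fun e => (e.filter (· ≤ v)).card) - 1 < r
    omega
  · simp only [key f hf v hv, key f hf w hw] at hvw
    have hpos : ∀ x ∈ f, 0 < (f.filter (· ≤ x)).card := fun x hx =>
      Finset.card_pos.2 ⟨x, Finset.mem_filter.2 ⟨hx, le_rfl⟩⟩
    have hlt : ∀ x ∈ f, ∀ y ∈ f, x < y → (f.filter (· ≤ x)).card < (f.filter (· ≤ y)).card := by
      intro x _ y hy hxy
      refine Finset.card_lt_card ⟨fun z hz => ?_, fun h => ?_⟩
      · rw [Finset.mem_filter] at hz ⊢
        exact ⟨hz.1, hz.2.trans hxy.le⟩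
      · exact hxy.not_ge (Finset.mem_filter.1 (h (Finset.mem_filter.2 ⟨hy, le_rfl⟩))).2
    have h1 := hpos v hv
    have h2 := hpos w hw
    rcases lt_trichotomy v w with h | h | h
    · have := hlt v hv w hw h
      omega
    · exact h
    · have := hlt w hw v hv h
      omega

theorem isRPartite_iff_isClique {r : ℕ} (hr : r ≠ 0) {M : Finset (Finset V)} :
    IsRPartite r M ↔ M.Nonempty ∧ IsClique (rPartitePatterns r) M := by
  rw [isRPartite_iff hr]
  constructor
  · exact fun h => ⟨h.2.1, h.1.isClique_of_hasColoring hr h.2.2⟩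
  · rintro ⟨hne, h⟩
    obtain ⟨c, hc, hk, hi⟩ := h.exists_monotone_coloring hr
    exact ⟨h.1, hne, c, hc.monotoneOn _, fun v _ => hk v, hi⟩

theorem isClique_empty {r : ℕ} (Pats : Finset (Finset (Finset (Fin (r * 2))))) :
    IsClique Pats (∅ : Finset (Finset V)) := by
  simp [IsClique, IsMatching]

theorem isClique_singleton {r : ℕ} (Pats : Finset (Finset (Finset (Fin (r * 2)))))
    {e : Finset V} (he : e.card = r) : IsClique Pats {e} := by
  simp [IsClique, IsMatching, he]

theorem IsClique.card_le_maxClique {r : ℕ} {Pats : Finset (Finset (Finset (Fin (r * 2))))}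
    {M N : Finset (Finset V)} (hN : IsClique Pats N) (h : N ⊆ M) :
    N.card ≤ maxClique Pats M := by
  classical
  exact Finset.le_sup (f := Finset.card)
    (Finset.mem_filter.2 ⟨Finset.mem_powerset.2 h, hN⟩)

theorem exists_isClique_card_eq_maxClique {r : ℕ} (Pats : Finset (Finset (Finset (Fin (r * 2)))))
    (M : Finset (Finset V)) : ∃ N ⊆ M, IsClique Pats N ∧ N.card = maxClique Pats M := by
  classical
  obtain ⟨N, hN, h⟩ := Finset.exists_mem_eq_sup (M.powerset.filter fun N => IsClique Pats N)
    ⟨∅, Finset.mem_filter.2 ⟨Finset.empty_mem_powerset M, isClique_empty Pats⟩⟩ Finset.card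
  rw [Finset.mem_filter, Finset.mem_powerset] at hN
  refine ⟨N, hN.1, hN.2, h.symm.trans ?_⟩
  unfold maxClique
  congr!

/-- The empty set is a clique but not `r`-partite. Since `M` has an edge, a maximum clique is
nonempty and the discrepancy is harmless. -/
theorem isLargestRPartite_iff {r : ℕ} (hr : r ≠ 0) {M N : Finset (Finset V)}
    (hM : IsMatching r M) (hne : M.Nonempty) :
    IsLargestRPartite r M N ↔
      N ⊆ M ∧ IsClique (rPartitePatterns r) N ∧ N.card = maxClique (rPartitePatterns r) M := by
  obtain ⟨e, he⟩ := hne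
  have hpos : 1 ≤ maxClique (rPartitePatterns r) M := by
    have := (isClique_singleton (rPartitePatterns r) (hM.1 e he)).card_le_maxClique
      (Finset.singleton_subset_iff.2 he)
    rwa [Finset.card_singleton] at this
  constructor
  · rintro ⟨hN, hR, hmax⟩
    have hc := ((isRPartite_iff_isClique hr).1 hR).2
    refine ⟨hN, hc, le_antisymm (hc.card_le_maxClique hN) ?_⟩
    obtain ⟨N', hN', hc', hcard⟩ := exists_isClique_card_eq_maxClique (rPartitePatterns r) M
    rw [← hcard]
    exact hmax N' hN' ((isRPartite_iff_isClique hr).2 ⟨Finset.card_pos.1 (by omega), hc'⟩)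
  · rintro ⟨hN, hc, hcard⟩
    refine ⟨hN, (isRPartite_iff_isClique hr).2 ⟨Finset.card_pos.1 (by omega), hc⟩,
      fun N' hN' hR => ?_⟩
    rw [hcard]
    exact ((isRPartite_iff_isClique hr).1 hR).2.card_le_maxClique hN'

end Clique

/-! ### Counting matchings that contain given edges -/

section Counting

variable {r n : ℕ}

theorem mem_matchings {M : Finset (Finset (Fin (r * n)))} :
    M ∈ matchings r n ↔ IsMatching r M ∧ M.card = n ∧ vertexSet M = Finset.univ := by
  classical
  simp [matchings]

/-- The number of matchings of size `n` on `[rn]` that contain the edges in `A`. -/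
noncomputable def countContaining (r n : ℕ) (A : Finset (Finset (Fin (r * n)))) : ℕ :=
  ((matchings r n).filter (A ⊆ ·)).card

theorem map_mem_matchings (σ : Equiv.Perm (Fin (r * n))) {M : Finset (Finset (Fin (r * n)))}
    (hM : M ∈ matchings r n) :
    M.map (Finset.mapEmbedding σ.toEmbedding).toEmbedding ∈ matchings r n := by
  rw [mem_matchings] at hM ⊢
  refine ⟨⟨fun e he => ?_, fun e he f hf hef => ?_⟩, ?_, ?_⟩
  · obtain ⟨e', he', rfl⟩ := Finset.mem_map.1 he
    simpa using hM.1.1 e' he'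
  · obtain ⟨e', he', rfl⟩ := Finset.mem_map.1 he
    obtain ⟨f', hf', rfl⟩ := Finset.mem_map.1 hf
    exact (Finset.disjoint_map σ.toEmbedding).2 (hM.1.2 e' he' f' hf' fun h => hef (h ▸ rfl))
  · exact (Finset.card_map _).trans hM.2.1
  · refine Finset.eq_univ_of_forall fun v => ?_
    obtain ⟨e, he, hv⟩ := mem_vertexSet.1 (hM.2.2 ▸ Finset.mem_univ (σ.symm v))
    exact mem_vertexSet.2 ⟨_, Finset.mem_map_of_mem _ he, by simpa using hv⟩

/-- Permutations of the vertices act on matchings, so only the sizes and intersections of the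
prescribed edges matter. -/
theorem countContaining_le_map (σ : Equiv.Perm (Fin (r * n))) (A : Finset (Finset (Fin (r * n)))) :
    countContaining r n A ≤
      countContaining r n (A.map (Finset.mapEmbedding σ.toEmbedding).toEmbedding) := by
  refine Finset.card_le_card_of_injOn
    (fun M => M.map (Finset.mapEmbedding σ.toEmbedding).toEmbedding) (fun M hM => ?_)
    fun M _ N _ h => Finset.map_injective _ h
  have hM := Finset.mem_filter.1 hM
  exact Finset.mem_filter.2 ⟨map_mem_matchings σ hM.1, Finset.map_subset_map.2 hM.2⟩

/-- Two pairs of disjoint sets of the same sizes differ by a permutation. -/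
theorem exists_perm_map_eq {α : Type*} [Fintype α] [DecidableEq α] {e f e' f' : Finset α}
    (h : Disjoint e f) (h' : Disjoint e' f') (he : e.card = e'.card) (hf : f.card = f'.card) :
    ∃ σ : Equiv.Perm α, e.map σ.toEmbedding = e' ∧ f.map σ.toEmbedding = f' := by
  -- Both pairs split the ground set into three classes of matching sizes; a permutation carries
  -- classes to classes.
  let c : Finset α → Finset α → α → Fin 3 := fun a b x => if x ∈ a then 0 else if x ∈ b then 1 else 2
  have hc0 : ∀ a b x, c a b x = 0 ↔ x ∈ a := by
    intro a b x
    simp only [c]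
    split_ifs <;> simp_all
  have hc1 : ∀ a b, Disjoint a b → ∀ x, c a b x = 1 ↔ x ∈ b := by
    intro a b hab x
    have := fun hx : x ∈ a => Finset.disjoint_left.1 hab hx
    simp only [c]
    split_ifs <;> simp_all
  have hc2 : ∀ a b, ∀ x, c a b x = 2 ↔ x ∈ (a ∪ b)ᶜ := by
    intro a b x
    simp only [c]
    split_ifs <;> simp_all
  have hcard : ∀ i, Fintype.card {x // c e f x = i} = Fintype.card {x // c e' f' x = i} := by
    intro i
    fin_cases i
    · simpa [hc0] using he
    · simpa [hc1 _ _ h, hc1 _ _ h'] using hf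
    · rw [Fintype.card_subtype, Fintype.card_subtype]
      have h1 : (Finset.univ.filter fun x => c e f x = 2) = (e ∪ f)ᶜ := by
        ext x
        rw [← hc2]
        simp
      have h2 : (Finset.univ.filter fun x => c e' f' x = 2) = (e' ∪ f')ᶜ := by
        ext x
        rw [← hc2]
        simp
      change (Finset.univ.filter fun x => c e f x = 2).card =
        (Finset.univ.filter fun x => c e' f' x = 2).card
      rw [h1, h2, Finset.card_compl, Finset.card_compl, Finset.card_union_of_disjoint h,
        Finset.card_union_of_disjoint h', he, hf]
  let σ := Equiv.ofFiberEquiv fun i => Fintype.equivOfCardEq (hcard i)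
  have hσ : ∀ x, c e' f' (σ x) = c e f x := Equiv.ofFiberEquiv_map _
  refine ⟨σ, ?_, ?_⟩
  · refine Finset.eq_of_subset_of_card_le (fun y hy => ?_) (by simp [he])
    obtain ⟨x, hx, rfl⟩ := Finset.mem_map.1 hy
    exact (hc0 e' f' _).1 ((hσ x).trans ((hc0 e f x).2 hx))
  · refine Finset.eq_of_subset_of_card_le (fun y hy => ?_) (by simp [hf])
    obtain ⟨x, hx, rfl⟩ := Finset.mem_map.1 hy
    exact (hc1 e' f' h' _).1 ((hσ x).trans ((hc1 e f h x).2 hx))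

theorem countContaining_pair_le {e f e' f' : Finset (Fin (r * n))} (h : Disjoint e f)
    (h' : Disjoint e' f') (he : e.card = e'.card) (hf : f.card = f'.card) :
    countContaining r n {e, f} ≤ countContaining r n {e', f'} := by
  obtain ⟨σ, rfl, rfl⟩ := exists_perm_map_eq h h' he hf
  simpa using countContaining_le_map σ {e, f}

theorem countContaining_pair_eq {e f e' f' : Finset (Fin (r * n))} (h : Disjoint e f)
    (h' : Disjoint e' f') (he : e.card = e'.card) (hf : f.card = f'.card) :
    countContaining r n {e, f} = countContaining r n {e', f'} :=
  le_antisymm (countContaining_pair_le h h' he hf)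
    (countContaining_pair_le h' h he.symm hf.symm)

theorem countContaining_singleton_le {e e' : Finset (Fin (r * n))} (he : e.card = e'.card) :
    countContaining r n {e} ≤ countContaining r n {e'} := by
  obtain ⟨σ, rfl, -⟩ := exists_perm_map_eq (Finset.disjoint_empty_right e)
    (Finset.disjoint_empty_right e') he rfl
  simpa using countContaining_le_map σ {e}

theorem sum_card_filter_subset {ι : Type*} (T : Finset ι)
    (A : ι → Finset (Finset (Fin (r * n)))) :
    ∑ M ∈ matchings r n, (T.filter fun a => A a ⊆ M).card = ∑ a ∈ T, countContaining r n (A a) :=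
  Finset.sum_card_bipartiteAbove_eq_sum_card_bipartiteBelow fun M a => A a ⊆ M

theorem sum_card_inter (F : Finset (Finset (Fin (r * n)))) :
    ∑ M ∈ matchings r n, (M ∩ F).card = ∑ e ∈ F, countContaining r n {e} := by
  rw [← sum_card_filter_subset F fun e => {e}]
  refine Finset.sum_congr rfl fun M _ => congrArg Finset.card ?_
  ext e
  simp [and_comm]

theorem sum_card_inter_sq (F : Finset (Finset (Fin (r * n)))) :
    ∑ M ∈ matchings r n, (M ∩ F).card ^ 2 =
      ∑ p ∈ F ×ˢ F, countContaining r n {p.1, p.2} := by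
  rw [← sum_card_filter_subset (F ×ˢ F) fun p => {p.1, p.2}]
  refine Finset.sum_congr rfl fun M _ => ?_
  rw [sq, ← Finset.card_product]
  congr 1
  ext ⟨e, f⟩
  simp only [Finset.mem_product, Finset.mem_inter, Finset.mem_filter, Finset.insert_subset_iff,
    Finset.singleton_subset_iff]
  tauto

/-- The number of matchings that contain a given edge. -/
theorem choose_mul_countContaining {e : Finset (Fin (r * n))} (he : e.card = r) :
    (r * n).choose r * countContaining r n {e} = n * (matchings r n).card := by
  -- Double counting over all `r`-sets: each matching contributes `n`, and by symmetry each `r`-set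
  -- contributes equally.
  have h := sum_card_inter (Finset.powersetCard r (Finset.univ : Finset (Fin (r * n))))
  rw [Finset.sum_congr rfl fun f hf => le_antisymm
    (countContaining_singleton_le ((Finset.mem_powersetCard.1 hf).2.trans he.symm))
    (countContaining_singleton_le (he.trans (Finset.mem_powersetCard.1 hf).2.symm)),
    Finset.sum_const, Finset.card_powersetCard, Finset.card_univ, Fintype.card_fin,
    smul_eq_mul] at h
  rw [← h, Finset.sum_congr rfl (g := fun _ => n), Finset.sum_const, smul_eq_mul, mul_comm]
  intro M hM
  rw [mem_matchings] at hM
  rw [Finset.inter_eq_left.2 fun f hf => Finset.mem_powersetCard.2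
    ⟨Finset.subset_univ _, hM.1.1 f hf⟩, hM.2.1]

/-- The number of matchings that contain two given disjoint edges. -/
theorem choose_mul_countContaining_pair (hr : r ≠ 0) {e f : Finset (Fin (r * n))}
    (he : e.card = r) (hf : f.card = r) (hef : Disjoint e f) :
    (r * n).choose r * (r * n - r).choose r * countContaining r n {e, f} =
      n * (n - 1) * (matchings r n).card := by
  let E := Finset.powersetCard r (Finset.univ : Finset (Fin (r * n)))
  have hE : ∀ g, g ∈ E ↔ g.card = r := fun g => by simp [E]
  -- Ordered pairs of disjoint `r`-sets; each matching contains `n * (n - 1)` of them.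
  let T := E.sigma fun g => Finset.powersetCard r gᶜ
  have hT : ∀ p, p ∈ T ↔ p.1.card = r ∧ Disjoint p.1 p.2 ∧ p.2.card = r := by
    intro p
    rw [Finset.mem_sigma, hE, Finset.mem_powersetCard, Finset.subset_compl_comm,
      Finset.subset_compl_iff_disjoint_right]
  have h := sum_card_filter_subset T fun p => ({p.1, p.2} : Finset (Finset (Fin (r * n))))
  have hTcard : T.card = (r * n).choose r * (r * n - r).choose r := by
    rw [Finset.card_sigma, Finset.sum_congr rfl (g := fun _ => (r * n - r).choose r),
      Finset.sum_const, smul_eq_mul]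
    · simp [E]
    · intro g hg
      rw [Finset.card_powersetCard, Finset.card_compl, (hE g).1 hg, Fintype.card_fin]
  rw [Finset.sum_congr rfl fun p hp => countContaining_pair_eq ((hT p).1 hp).2.1 hef
    (((hT p).1 hp).1.trans he.symm) (((hT p).1 hp).2.2.trans hf.symm), Finset.sum_const,
    smul_eq_mul, hTcard] at h
  rw [← h, Finset.sum_congr rfl (g := fun _ => n * (n - 1)), Finset.sum_const, smul_eq_mul,
    mul_comm]
  intro M hM
  rw [mem_matchings] at hM
  have hoff : M.offDiag.card = n * (n - 1) := by
    rw [Finset.offDiag_card, hM.2.1, Nat.mul_sub_one]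
  rw [← hoff]
  refine Finset.card_bij (fun p _ => (p.1, p.2)) ?_ ?_ ?_
  · rintro ⟨g, g'⟩ hp
    rw [Finset.mem_filter, hT, Finset.insert_subset_iff, Finset.singleton_subset_iff] at hp
    refine Finset.mem_offDiag.2 ⟨hp.2.1, hp.2.2, fun hgg => ?_⟩
    obtain ⟨⟨h1, h2, -⟩, -⟩ := hp
    simp only at hgg h1 h2
    rw [← hgg, disjoint_self] at h2
    rw [h2] at h1
    exact hr h1.symm
  · rintro ⟨g, g'⟩ _ ⟨k, k'⟩ _ hp
    simp only [Prod.mk.injEq] at hp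
    obtain ⟨rfl, rfl⟩ := hp
    rfl
  · rintro ⟨g, g'⟩ hp
    obtain ⟨hg, hg', hne⟩ := Finset.mem_offDiag.1 hp
    refine ⟨⟨g, g'⟩, ?_, rfl⟩
    rw [Finset.mem_filter, hT, Finset.insert_subset_iff, Finset.singleton_subset_iff]
    exact ⟨⟨hM.1.1 g hg, hM.1.2 g hg g' hg' hne, hM.1.1 g' hg'⟩, hg, hg'⟩

theorem countContaining_pair_eq_zero {e f : Finset (Fin (r * n))} (hne : e ≠ f)
    (hef : ¬ Disjoint e f) : countContaining r n {e, f} = 0 := by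
  rw [countContaining, Finset.card_eq_zero, Finset.filter_eq_empty_iff]
  intro M hM h
  rw [Finset.insert_subset_iff, Finset.singleton_subset_iff] at h
  exact hef ((mem_matchings.1 hM).1.2 e h.1 f h.2 hne)

end Counting

/-! ### Second moment and Chebyshev's inequality -/

section Concentration

variable {r n : ℕ}

theorem sum_card_inter_eq (hn : 1 ≤ n) {F : Finset (Finset (Fin (r * n)))}
    (hF : ∀ e ∈ F, e.card = r) :
    ∑ M ∈ matchings r n, ((M ∩ F).card : ℝ) =
      F.card * (n / (r * n).choose r) * (matchings r n).card := by
  have hC : (0 : ℝ) < (r * n).choose r := by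
    exact_mod_cast Nat.choose_pos (Nat.le_mul_of_pos_right r hn)
  have h := sum_card_inter F
  have h' : ∑ M ∈ matchings r n, ((M ∩ F).card : ℝ) = ∑ e ∈ F, (countContaining r n {e} : ℝ) := by
    exact_mod_cast h
  rw [h', Finset.sum_congr rfl (g := fun _ => (n / (r * n).choose r * (matchings r n).card : ℝ)),
    Finset.sum_const, nsmul_eq_mul, mul_assoc]
  intro e he
  have : ((r * n).choose r * countContaining r n {e} : ℝ) = n * (matchings r n).card := by
    exact_mod_cast choose_mul_countContaining (hF e he)
  field_simp
  linarith

/-- Diagonal pairs give the first moment, disjoint pairs all have the same probability, and distinct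
intersecting pairs never occur together. Counting every pair of `F` as disjoint gives the second
term. -/
theorem sum_card_inter_sq_le (hr : r ≠ 0) (hn : 2 ≤ n) {F : Finset (Finset (Fin (r * n)))}
    (hF : ∀ e ∈ F, e.card = r) :
    ∑ M ∈ matchings r n, ((M ∩ F).card : ℝ) ^ 2 ≤
      (F.card * (n / (r * n).choose r) + (F.card : ℝ) ^ 2 *
        (n * (n - 1) / ((r * n).choose r * (r * n - r).choose r))) * (matchings r n).card := by
  have hC : (0 : ℝ) < (r * n).choose r := by
    exact_mod_cast Nat.choose_pos (Nat.le_mul_of_pos_right r (by omega))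
  have hC' : (0 : ℝ) < (r * n - r).choose r := by
    have : r * 2 ≤ r * n := Nat.mul_le_mul_left r hn
    exact_mod_cast Nat.choose_pos (by omega)
  have h' : ∑ M ∈ matchings r n, ((M ∩ F).card : ℝ) ^ 2 =
      ∑ p ∈ F ×ˢ F, (countContaining r n {p.1, p.2} : ℝ) := by
    exact_mod_cast sum_card_inter_sq F
  set q : ℝ := n * (n - 1) / ((r * n).choose r * (r * n - r).choose r) * (matchings r n).card
    with hq
  have hn1 : (1 : ℝ) ≤ n := by exact_mod_cast (by omega : 1 ≤ n)
  have hq0 : 0 ≤ q := by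
    have : (0 : ℝ) ≤ n - 1 := by linarith
    positivity
  have hle : ∀ p ∈ F ×ˢ F, (countContaining r n {p.1, p.2} : ℝ) ≤
      (if p.1 = p.2 then (countContaining r n {p.1} : ℝ) else 0) + q := by
    rintro ⟨e, f⟩ hp
    rw [Finset.mem_product] at hp
    simp only at hp ⊢
    split_ifs with hef
    · subst hef
      rw [Finset.pair_eq_singleton]
      linarith
    · rw [zero_add]
      by_cases hd : Disjoint e f
      · have h2 := choose_mul_countContaining_pair hr (hF e hp.1) (hF f hp.2) hd
        have h3 : ((r * n).choose r * (r * n - r).choose r * countContaining r n {e, f} : ℝ) =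
            n * (n - 1) * (matchings r n).card := by
          have := congrArg (Nat.cast (R := ℝ)) h2
          push_cast [Nat.cast_sub (by omega : 1 ≤ n)] at this
          exact this
        rw [hq]
        refine le_of_eq ?_
        field_simp
        linarith
      · rw [countContaining_pair_eq_zero hef hd]
        exact_mod_cast hq0
  rw [h']
  refine (Finset.sum_le_sum hle).trans ?_
  rw [Finset.sum_add_distrib, Finset.sum_const, Finset.card_product, Finset.sum_product]
  simp only [Finset.sum_ite_eq]
  have h4 : ∑ e ∈ F, (if e ∈ F then (countContaining r n {e} : ℝ) else 0) =
      F.card * (n / (r * n).choose r) * (matchings r n).card := by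
    rw [← sum_card_inter_eq (by omega) hF]
    rw [Finset.sum_congr rfl fun e he => if_pos he]
    exact_mod_cast (sum_card_inter F).symm
  rw [h4, hq, nsmul_eq_mul]
  push_cast
  refine le_of_eq ?_
  ring

/-- The bound for the relative variance of the number of edges in a given family. -/
noncomputable def varianceBound (r n : ℕ) : ℝ :=
  1 / n + ((r * n).choose r / (r * n - r).choose r - 1)

theorem sum_sq_sub_le (hr : r ≠ 0) (hn : 2 ≤ n) {F : Finset (Finset (Fin (r * n)))}
    (hF : ∀ e ∈ F, e.card = r) :
    ∑ M ∈ matchings r n, ((M ∩ F).card - F.card * (n / (r * n).choose r) : ℝ) ^ 2 ≤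
      n ^ 2 * varianceBound r n * (matchings r n).card := by
  have hC : (0 : ℝ) < (r * n).choose r := by
    exact_mod_cast Nat.choose_pos (Nat.le_mul_of_pos_right r (by omega))
  have hC' : (0 : ℝ) < (r * n - r).choose r := by
    have : r * 2 ≤ r * n := Nat.mul_le_mul_left r hn
    exact_mod_cast Nat.choose_pos (by omega)
  have hCC : ((r * n - r).choose r : ℝ) ≤ (r * n).choose r := by
    exact_mod_cast Nat.choose_le_choose r (Nat.sub_le _ _)
  have hFC : (F.card : ℝ) ≤ (r * n).choose r := by
    have : F.card ≤ (Finset.powersetCard r (Finset.univ : Finset (Fin (r * n)))).card :=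
      Finset.card_le_card fun e he => by simp [hF e he]
    rw [Finset.card_powersetCard, Finset.card_univ, Fintype.card_fin] at this
    exact_mod_cast this
  have hn0 : (0 : ℝ) < n := by exact_mod_cast (by omega : 0 < n)
  have h1 := sum_card_inter_eq (by omega) hF
  have h2 := sum_card_inter_sq_le hr hn hF
  set W : ℝ := ((matchings r n).card : ℝ)
  set C : ℝ := ((r * n).choose r : ℝ)
  set C' : ℝ := ((r * n - r).choose r : ℝ)
  set x : ℝ := F.card / C with hx
  have hx0 : 0 ≤ x := by positivity
  have hx1 : x ≤ 1 := (div_le_one hC).2 hFC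
  have hFx : (F.card : ℝ) = x * C := by rw [hx]; field_simp
  have hmu : (F.card : ℝ) * (n / C) = x * n := by rw [hFx]; field_simp
  rw [hmu] at h1 h2 ⊢
  have hexp : ∑ M ∈ matchings r n, ((M ∩ F).card - x * n : ℝ) ^ 2 =
      ∑ M ∈ matchings r n, ((M ∩ F).card : ℝ) ^ 2 - (x * n) ^ 2 * W := by
    have : ∀ M : Finset (Finset (Fin (r * n))), ((M ∩ F).card - x * n : ℝ) ^ 2 =
        ((M ∩ F).card : ℝ) ^ 2 - 2 * (x * n) * (M ∩ F).card + (x * n) ^ 2 := fun M => by ring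
    rw [Finset.sum_congr rfl fun M _ => this M, Finset.sum_add_distrib, Finset.sum_sub_distrib,
      ← Finset.mul_sum, h1, Finset.sum_const, nsmul_eq_mul]
    ring
  have hW0 : 0 ≤ W := Nat.cast_nonneg _
  rw [hexp]
  have h3 : (F.card : ℝ) ^ 2 * (n * (n - 1) / (C * C')) = x ^ 2 * (C / C') * (n * (n - 1)) := by
    rw [hFx]
    field_simp
  rw [h3] at h2
  -- With `ρ = C / C' - 1 ≥ 0` the left side is `x * n + x ^ 2 * ρ * n ^ 2 - x ^ 2 * (ρ + 1) * n`.
  -- Dropping the last term and using `x ≤ 1` makes the bound independent of `F`.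
  have hb : x * n + x ^ 2 * (C / C') * (n * (n - 1)) - (x * n) ^ 2 ≤
      n ^ 2 * (1 / n + (C / C' - 1)) := by
    have hρ : 0 ≤ C / C' - 1 := sub_nonneg.2 ((one_le_div hC').2 hCC)
    set ρ := C / C' - 1 with hρdef
    have : C / C' = ρ + 1 := by rw [hρdef]; ring
    rw [this]
    have e1 : (n : ℝ) ^ 2 * (1 / n + ρ) = n + n ^ 2 * ρ := by
      rw [mul_add, sq, mul_assoc, mul_one_div_cancel hn0.ne', mul_one]
    rw [e1]
    have hx2 : x ^ 2 ≤ 1 := pow_le_one₀ hx0 hx1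
    have a1 : x * n ≤ n := mul_le_of_le_one_left hn0.le hx1
    have a2 : x ^ 2 * (n ^ 2 * ρ) ≤ n ^ 2 * ρ := mul_le_of_le_one_left (mul_nonneg (sq_nonneg _) hρ) hx2
    have a3 : 0 ≤ x ^ 2 * (ρ + 1) * n :=
      mul_nonneg (mul_nonneg (sq_nonneg x) (by linarith)) hn0.le
    nlinarith
  have := mul_le_mul_of_nonneg_right hb hW0
  rw [varianceBound]
  nlinarith

theorem probRM_deviation_le (hr : r ≠ 0) (hn : 2 ≤ n) {F : Finset (Finset (Fin (r * n)))}
    (hF : ∀ e ∈ F, e.card = r) {δ : ℝ} (hδ : 0 < δ) :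
    probRM r n (fun M => δ * n ≤ |(M ∩ F).card - F.card * (n / (r * n).choose r : ℝ)|) ≤
      varianceBound r n / δ ^ 2 := by
  classical
  have hW : (0 : ℝ) < (matchings r n).card := by
    exact_mod_cast (matchings_nonempty hr n).card_pos
  have hn0 : (0 : ℝ) < n := by exact_mod_cast (by omega : 0 < n)
  rw [probRM, div_le_div_iff₀ hW (by positivity)]
  have h := sum_sq_sub_le hr hn hF
  set p := fun M : Finset (Finset (Fin (r * n))) =>
    δ * n ≤ |(M ∩ F).card - F.card * (n / (r * n).choose r : ℝ)| with hp
  have h1 : (((matchings r n).filter p).card : ℝ) * (δ * n) ^ 2 ≤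
      ∑ M ∈ matchings r n, ((M ∩ F).card - F.card * (n / (r * n).choose r) : ℝ) ^ 2 := by
    rw [← nsmul_eq_mul]
    refine (Finset.card_nsmul_le_sum _ (fun M : Finset (Finset (Fin (r * n))) =>
      ((M ∩ F).card - F.card * (n / (r * n).choose r) : ℝ) ^ 2) _ fun M hM => ?_).trans
      (Finset.sum_le_sum_of_subset_of_nonneg (Finset.filter_subset _ _)
        fun _ _ _ => sq_nonneg _)
    have := (Finset.mem_filter.1 hM).2
    rw [← sq_abs ((M ∩ F).card - _ : ℝ)]
    exact pow_le_pow_left₀ (by positivity) this 2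
  have h2 := h1.trans h
  have h3 : (n : ℝ) ^ 2 * ((((matchings r n).filter p).card : ℝ) * δ ^ 2) ≤
      (n : ℝ) ^ 2 * (varianceBound r n * (matchings r n).card) := by nlinarith
  have := le_of_mul_le_mul_left h3 (by positivity)
  refine le_of_eq_of_le ?_ this
  congr!

end Concentration

/-! ### Rainbow sets and block colorings -/

section Rainbow

variable {r n : ℕ}

open Classical in
/-- The `r`-element sets on which the coloring `c` is injective. -/
noncomputable def rainbow (c : Fin (r * n) → Fin r) : Finset (Finset (Fin (r * n))) :=
  (Finset.powersetCard r Finset.univ).filter fun e => Set.InjOn c e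

theorem mem_rainbow {c : Fin (r * n) → Fin r} {e : Finset (Fin (r * n))} :
    e ∈ rainbow c ↔ e.card = r ∧ Set.InjOn c e := by
  classical
  simp [rainbow]

/-- With `r` vertices and `r` colors, a rainbow set picks exactly one vertex from each class. -/
theorem card_rainbow (c : Fin (r * n) → Fin r) :
    (rainbow c).card = ∏ i, (Finset.univ.filter fun v => c v = i).card := by
  classical
  rw [← Fintype.card_piFinset]
  symm
  have hs : ∀ s ∈ Fintype.piFinset fun i => Finset.univ.filter fun v => c v = i,
      ∀ i, c (s i) = i := by
    intro s hs i
    simpa using Fintype.mem_piFinset.1 hs i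
  refine Finset.card_bij (fun s _ => Finset.univ.image s) (fun s h => ?_)
    (fun s h t h' hst => ?_) fun e he => ?_
  · have hinj : Function.Injective s := fun i j hij => by rw [← hs s h i, hij, hs s h j]
    refine mem_rainbow.2 ⟨by rw [Finset.card_image_of_injective _ hinj, Finset.card_fin], ?_⟩
    intro v hv w hw hvw
    obtain ⟨i, -, rfl⟩ := Finset.mem_image.1 hv
    obtain ⟨j, -, rfl⟩ := Finset.mem_image.1 hw
    rw [hs s h, hs s h] at hvw
    rw [hvw]
  · funext i
    have hi : s i ∈ Finset.univ.image t := hst ▸ Finset.mem_image_of_mem s (Finset.mem_univ i)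
    obtain ⟨j, -, hj⟩ := Finset.mem_image.1 hi
    have := congrArg c hj
    rw [hs s h, hs t h'] at this
    rw [← hj, this]
  · rw [mem_rainbow] at he
    have hsurj : e.image c = Finset.univ := Finset.eq_univ_of_card _ (by
      rw [Finset.card_image_of_injOn he.2, he.1, Fintype.card_fin])
    have hex : ∀ i, ∃ v ∈ e, c v = i := fun i =>
      Finset.mem_image.1 (hsurj ▸ Finset.mem_univ i)
    choose s hse hsc using hex
    refine ⟨s, Fintype.mem_piFinset.2 fun i => by simp [hsc i], ?_⟩
    ext v
    simp only [Finset.mem_image, Finset.mem_univ, true_and]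
    constructor
    · rintro ⟨i, rfl⟩
      exact hse i
    · exact fun hv => ⟨c v, he.2 (hse _) hv (hsc _)⟩

theorem prod_le_pow_of_sum_eq (hr : r ≠ 0) {a : Fin r → ℕ} (h : ∑ i, a i = r * n) :
    ∏ i, a i ≤ n ^ r := by
  have hr' : (0 : ℝ) < r := by exact_mod_cast Nat.pos_of_ne_zero hr
  have key := Real.geom_mean_le_arith_mean_weighted Finset.univ (fun _ : Fin r => (1 / r : ℝ))
    (fun i => (a i : ℝ)) (fun _ _ => by positivity) (by simp [hr]) (fun _ _ => by positivity)
  rw [← Finset.mul_sum, ← Nat.cast_sum, h, Real.finsetProd_rpow _ _ fun _ _ => by positivity] at key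
  have h2 : (1 / r : ℝ) * ((r * n : ℕ) : ℝ) = n := by
    push_cast
    field_simp
  rw [h2] at key
  have h3 := pow_le_pow_left₀ (by positivity) key r
  rw [← Real.rpow_natCast, ← Real.rpow_mul (by positivity), one_div_mul_cancel hr'.ne',
    Real.rpow_one] at h3
  exact_mod_cast h3

theorem card_rainbow_le (hr : r ≠ 0) (c : Fin (r * n) → Fin r) : (rainbow c).card ≤ n ^ r := by
  rw [card_rainbow]
  refine prod_le_pow_of_sum_eq hr ?_
  rw [← Finset.card_eq_sum_card_fiberwise fun v _ => Finset.mem_univ (c v), Finset.card_fin]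

theorem card_rainbow_divNat : (rainbow (Fin.divNat : Fin (r * n) → Fin r)).card = n ^ r := by
  rw [card_rainbow, Finset.prod_congr rfl (g := fun _ => n), Finset.prod_const, Finset.card_fin]
  intro i _
  refine ((Finset.card_fin n).symm.trans ?_).symm
  refine Finset.card_bij (fun j _ => finProdFinEquiv (i, j)) (fun j _ => ?_)
    (fun j _ k _ h => ?_) fun v hv => ?_
  · have := congrArg Prod.fst (finProdFinEquiv.symm_apply_apply (i, j))
    exact Finset.mem_filter.2 ⟨Finset.mem_univ _, this⟩
  · simpa using h
  · refine ⟨v.modNat, Finset.mem_univ _, ?_⟩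
    rw [← (Finset.mem_filter.1 hv).2]
    exact finProdFinEquiv.apply_symm_apply v

/-- The lower bound: `Fin.divNat` is monotone with `r` classes of size `n`, so its rainbow edges
form a clique. -/
theorem card_inter_rainbow_divNat_le_maxClique (hr : r ≠ 0) {M : Finset (Finset (Fin (r * n)))}
    (hM : IsMatching r M) :
    (M ∩ rainbow Fin.divNat).card ≤ maxClique (rPartitePatterns r) M := by
  refine IsClique.card_le_maxClique ((hM.mono Finset.inter_subset_left).isClique_of_hasColoring hr
    ⟨fun v => v.divNat, fun v _ w _ hvw => Nat.div_le_div_right hvw, fun v _ => v.divNat.2,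
      fun e he v hv w hw hvw => ?_⟩) Finset.inter_subset_left
  exact (mem_rainbow.1 (Finset.mem_inter.1 he).2).2 hv hw (Fin.ext hvw)

/-- The coloring that is constant on consecutive blocks of length `L`. -/
def blockColoring {B L : ℕ} (h : r * n ≤ L * B) (g : Fin B → Fin r) (v : Fin (r * n)) : Fin r :=
  g ⟨v / L, Nat.div_lt_of_lt_mul (v.2.trans_le h)⟩

/-- Each block receives the largest value of `c` on it. A vertex is miscolored only if some
threshold `i < r` satisfies `c v < i ≤` its new color; for each `i` this happens only in the one
block where `c` first reaches `i`. -/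
theorem exists_blockColoring_close (hr : r ≠ 0) {B L : ℕ} (h : r * n ≤ L * B)
    {c : Fin (r * n) → ℕ} (hc : Monotone c) (hk : ∀ v, c v < r) :
    ∃ g : Fin B → Fin r,
      (Finset.univ.filter fun v => c v ≠ (blockColoring h g v : ℕ)).card ≤ r * L := by
  classical
  let s : Fin B → ℕ := fun j => (Finset.univ.filter fun v : Fin (r * n) => (v : ℕ) / L = j).sup c
  have hs : ∀ j, s j < r := fun j =>
    (Finset.sup_lt_iff (Nat.pos_of_ne_zero hr)).2 fun v _ => hk v
  have hsv : ∀ v : Fin (r * n), (blockColoring h (fun j => ⟨s j, hs j⟩) v : ℕ) =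
      (Finset.univ.filter fun w : Fin (r * n) => (w : ℕ) / L = (v : ℕ) / L).sup c := fun _ => rfl
  have hle : ∀ v, c v ≤ (blockColoring h (fun j => ⟨s j, hs j⟩) v : ℕ) := fun v => by
    rw [hsv]
    exact Finset.le_sup (f := c) (Finset.mem_filter.2 ⟨Finset.mem_univ v, rfl⟩)
  refine ⟨fun j => ⟨s j, hs j⟩, ?_⟩
  let bad : ℕ → Finset (Fin (r * n)) := fun i => Finset.univ.filter fun v =>
    c v < i ∧ i ≤ (blockColoring h (fun j => ⟨s j, hs j⟩) v : ℕ)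
  have hblock : ∀ i, ∀ v ∈ bad i, ∀ w ∈ bad i, (w : ℕ) / L ≤ (v : ℕ) / L := by
    intro i v hv w hw
    have hv := (Finset.mem_filter.1 hv).2
    have hw := (Finset.mem_filter.1 hw).2
    rw [hsv] at hv
    by_contra! hlt
    have hpos : ⊥ < i := (Nat.zero_le _).trans_lt hv.1
    obtain ⟨u, hu, hiu⟩ := (Finset.le_sup_iff hpos).1 hv.2
    have hu := (Finset.mem_filter.1 hu).2
    -- Some `u` in the block of `v` already has `c u ≥ i`; a bad `w` in a later block would then
    -- have `c w ≥ i`.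
    have huw : u ≤ w := by
      by_contra! hwu
      have : (w : ℕ) / L ≤ (u : ℕ) / L := Nat.div_le_div_right hwu.le
      rw [hu] at this
      exact hlt.not_ge this
    exact absurd (hiu.trans (hc huw)) hw.1.not_ge
  have hcard : ∀ i, (bad i).card ≤ L := by
    intro i
    rcases (bad i).eq_empty_or_nonempty with h0 | ⟨v, hv⟩
    · simp [h0]
    calc (bad i).card ≤ (Finset.range L).card := by
          refine Finset.card_le_card_of_injOn (fun w => (w : ℕ) % L) (fun w _ => ?_) ?_
          · have hL : 0 < L := Nat.pos_of_ne_zero fun h0 => by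
              have := w.2
              simp [h0] at h
              rcases h with h | h <;> simp [h] at this
            exact Finset.mem_coe.2 (Finset.mem_range.2 (Nat.mod_lt _ hL))
          · intro w hw w' hw' hww
            have hd := le_antisymm (hblock i w' hw' w hw) (hblock i w hw w' hw')
            simp only at hww
            rw [Fin.ext_iff, ← Nat.div_add_mod (w : ℕ) L, hd, hww, Nat.div_add_mod]
      _ = L := Finset.card_range L
  calc (Finset.univ.filter fun v => c v ≠ (blockColoring h (fun j => ⟨s j, hs j⟩) v : ℕ)).card
      ≤ ((Finset.range r).biUnion bad).card := by
        refine Finset.card_le_card fun v hv => ?_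
        have hv := (Finset.mem_filter.1 hv).2
        exact Finset.mem_biUnion.2 ⟨_, Finset.mem_range.2 (Fin.is_lt _), Finset.mem_filter.2
          ⟨Finset.mem_univ v, lt_of_le_of_ne (hle v) hv, le_rfl⟩⟩
    _ ≤ (Finset.range r).card * L := Finset.card_biUnion_le_card_mul _ _ _ fun i _ => hcard i
    _ = r * L := by rw [Finset.card_range]

/-- A clique edge that is not rainbow for the block coloring contains a miscolored vertex. Edges are
disjoint, so at most `r * L` edges are lost. -/
theorem exists_maxClique_le (hr : r ≠ 0) {B L : ℕ} (h : r * n ≤ L * B)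
    {M : Finset (Finset (Fin (r * n)))} (hM : IsMatching r M) :
    ∃ g : Fin B → Fin r, maxClique (rPartitePatterns r) M ≤
      (M ∩ rainbow (blockColoring h g)).card + r * L := by
  classical
  obtain ⟨N, hNM, hN, hcard⟩ := exists_isClique_card_eq_maxClique (rPartitePatterns r) M
  obtain ⟨c, hc, hk, hi⟩ := hN.exists_monotone_coloring hr
  obtain ⟨g, hg⟩ := exists_blockColoring_close hr h hc hk
  refine ⟨g, ?_⟩
  rw [← hcard, ← Finset.card_inter_add_card_sdiff N (rainbow (blockColoring h g))]
  refine add_le_add (Finset.card_le_card (Finset.inter_subset_inter_right hNM))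
    (le_trans ?_ hg)
  have hex : ∀ e ∈ N \ rainbow (blockColoring h g), ∃ v ∈ e,
      c v ≠ (blockColoring h g v : ℕ) := by
    intro e he
    rw [Finset.mem_sdiff, mem_rainbow] at he
    by_contra! hall
    refine he.2 ⟨hM.1 e (hNM he.1), fun v hv w hw hvw => hi e he.1 hv hw ?_⟩
    rw [hall v hv, hall w hw, hvw]
  refine Finset.card_le_card_of_forall_subsingleton (fun e v => v ∈ e) (fun e he => ?_)
    fun v _ e he f hf => ?_
  · obtain ⟨v, hv, hvc⟩ := hex e he
    exact ⟨v, Finset.mem_filter.2 ⟨Finset.mem_univ v, hvc⟩, hv⟩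
  · by_contra hne
    exact Finset.disjoint_left.1 (hM.2 e (hNM (Finset.mem_sdiff.1 he.1).1) f
      (hNM (Finset.mem_sdiff.1 hf.1).1) hne) he.2 hf.2

end Rainbow

/-! ### Asymptotics of the mean and of the variance bound -/

section Limit

theorem tendsto_choose_div_pow {r : ℕ} (hr : r ≠ 0) :
    Tendsto (fun n : ℕ => ((r * n).choose r : ℝ) / (n : ℝ) ^ r) atTop
      (𝓝 ((r : ℝ) ^ r / r.factorial)) := by
  have hmul : Tendsto (fun n : ℕ => r * n) atTop atTop :=
    tendsto_id.const_mul_atTop' (Nat.pos_of_ne_zero hr)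
  have h := ((isEquivalent_choose r).comp_tendsto hmul).div
    (Asymptotics.IsEquivalent.refl (u := fun n : ℕ => (n : ℝ) ^ r))
  refine h.symm.tendsto_nhds (tendsto_const_nhds.congr' ?_)
  filter_upwards [eventually_gt_atTop 0] with n hn
  have : (n : ℝ) ≠ 0 := by positivity
  simp only [Pi.div_apply, Function.comp_apply]
  push_cast
  rw [mul_pow]
  field_simp

theorem tendsto_pow_div_choose {r : ℕ} (hr : r ≠ 0) :
    Tendsto (fun n : ℕ => (n : ℝ) ^ r / ((r * n).choose r : ℝ)) atTop
      (𝓝 (((r - 1).factorial : ℝ) / (r : ℝ) ^ (r - 1))) := by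
  have hr' : (r : ℝ) ≠ 0 := Nat.cast_ne_zero.2 hr
  have h := (tendsto_choose_div_pow hr).inv₀ (by positivity)
  have e : ((r : ℝ) ^ r / r.factorial)⁻¹ = ((r - 1).factorial : ℝ) / (r : ℝ) ^ (r - 1) := by
    obtain ⟨k, rfl⟩ := Nat.exists_eq_succ_of_ne_zero hr
    rw [Nat.succ_sub_one, Nat.factorial_succ, pow_succ]
    push_cast at hr' ⊢
    field_simp
  rw [e] at h
  simpa using h

/-- Since `r * n - r = r * (n - 1)`, the two binomials are consecutive terms of one sequence
asymptotic to a constant times `n ^ r`, so their ratio tends to `1`. -/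
theorem tendsto_varianceBound {r : ℕ} (hr : r ≠ 0) :
    Tendsto (varianceBound r) atTop (𝓝 0) := by
  have hr' : (r : ℝ) ≠ 0 := Nat.cast_ne_zero.2 hr
  have h1 := tendsto_choose_div_pow hr
  have h2 := h1.comp (tendsto_sub_atTop_nat 1)
  have h3 : Tendsto (fun n : ℕ => (n : ℝ) / ((n - 1 : ℕ) : ℝ)) atTop (𝓝 1) := by
    rw [← tendsto_add_atTop_iff_nat 1]
    have := (tendsto_one_div_atTop_nhds_zero_nat (𝕜 := ℝ)).const_add 1
    rw [add_zero] at this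
    refine this.congr' ?_
    filter_upwards [eventually_gt_atTop 0] with n hn
    have : (n : ℝ) ≠ 0 := by positivity
    rw [Nat.add_sub_cancel]
    push_cast
    field_simp
  have h4 := (h1.div h2 (by positivity)).mul (h3.pow r)
  rw [div_self (by positivity), one_pow, one_mul] at h4
  have h5 := (tendsto_one_div_atTop_nhds_zero_nat (𝕜 := ℝ)).add (h4.sub_const 1)
  rw [sub_self, add_zero] at h5
  refine h5.congr' ?_
  filter_upwards [eventually_ge_atTop 2] with n hn
  have e : r * n - r = r * (n - 1) := by rw [Nat.mul_sub_one]
  have hn0 : (n : ℝ) ≠ 0 := by positivity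
  have hn1 : ((n - 1 : ℕ) : ℝ) ≠ 0 := Nat.cast_ne_zero.2 (by omega)
  simp only [varianceBound, Pi.div_apply, Function.comp_apply, e]
  rw [div_pow]
  congr 2
  field_simp

end Limit

/-! ### Union bound and convergence in probability -/

section Probability

variable {r n : ℕ}

theorem probRM_le_one (p : Finset (Finset (Fin (r * n))) → Prop) : probRM r n p ≤ 1 := by
  classical
  rw [probRM]
  refine div_le_one_of_le₀ ?_ (Nat.cast_nonneg _)
  exact_mod_cast Finset.card_filter_le _ _

theorem one_sub_sum_probRM_le (hr : r ≠ 0) {ι : Type*} (s : Finset ι)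
    {p : Finset (Finset (Fin (r * n))) → Prop} {q : ι → Finset (Finset (Fin (r * n))) → Prop}
    (h : ∀ M ∈ matchings r n, (∀ i ∈ s, ¬ q i M) → p M) :
    1 - ∑ i ∈ s, probRM r n (q i) ≤ probRM r n p := by
  classical
  have hW : (0 : ℝ) < (matchings r n).card := by
    exact_mod_cast (matchings_nonempty hr n).card_pos
  have hcard : (matchings r n).card ≤
      ((matchings r n).filter p).card + ∑ i ∈ s, ((matchings r n).filter (q i)).card := by
    calc (matchings r n).card
        ≤ ((matchings r n).filter p ∪ s.biUnion fun i => (matchings r n).filter (q i)).card := by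
          refine Finset.card_le_card fun M hM => ?_
          simp only [Finset.mem_union, Finset.mem_filter, Finset.mem_biUnion]
          by_cases hq : ∀ i ∈ s, ¬ q i M
          · exact Or.inl ⟨hM, h M hM hq⟩
          · push Not at hq
            obtain ⟨i, hi, hiq⟩ := hq
            exact Or.inr ⟨i, hi, hM, hiq⟩
      _ ≤ _ := (Finset.card_union_le _ _).trans (Nat.add_le_add_left Finset.card_biUnion_le _)
  have hcard' : ((matchings r n).card : ℝ) ≤
      ((matchings r n).filter p).card + ∑ i ∈ s, (((matchings r n).filter (q i)).card : ℝ) := by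
    exact_mod_cast hcard
  have hp : probRM r n p = ((matchings r n).filter p).card / (matchings r n).card := by
    unfold probRM
    congr!
  have hq : ∀ i, probRM r n (q i) =
      ((matchings r n).filter (q i)).card / (matchings r n).card := by
    intro i
    unfold probRM
    congr!
  rw [hp, Finset.sum_congr rfl fun i _ => hq i, ← Finset.sum_div, sub_le_iff_le_add, ← add_div,
    one_le_div hW]
  exact hcard'

/-- If no block coloring and not the balanced coloring has an exceptional number of rainbow
edges, then the largest clique has the expected size. -/
theorem abs_maxClique_sub_lt (hr : r ≠ 0) {K : ℕ} {δ α : ℝ}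
    (h : r * n ≤ (n / K + 1) * (r * K)) {M : Finset (Finset (Fin (r * n)))}
    (hM : IsMatching r M) (hα : |(n : ℝ) ^ r / (r * n).choose r - α| < δ)
    (hL : (r * (n / K + 1 : ℕ) : ℝ) ≤ 2 * δ * n)
    (h1 : |(M ∩ rainbow Fin.divNat).card -
      (rainbow (Fin.divNat : Fin (r * n) → Fin r)).card * (n / (r * n).choose r : ℝ)| < δ * n)
    (h2 : ∀ g, |(M ∩ rainbow (blockColoring h g)).card -
      (rainbow (blockColoring h g)).card * (n / (r * n).choose r : ℝ)| < δ * n) :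
    |(maxClique (rPartitePatterns r) M : ℝ) - α * n| ≤ 4 * δ * n := by
  have hn0 : (0 : ℝ) ≤ n := Nat.cast_nonneg n
  have e : (n : ℝ) ^ r * (n / (r * n).choose r) = (n : ℝ) ^ r / (r * n).choose r * n := by ring
  rw [card_rainbow_divNat, Nat.cast_pow, e] at h1
  set β : ℝ := (n : ℝ) ^ r / (r * n).choose r with hβ
  have hlow : ((M ∩ rainbow Fin.divNat).card : ℝ) ≤ maxClique (rPartitePatterns r) M := by
    exact_mod_cast card_inter_rainbow_divNat_le_maxClique hr hM
  obtain ⟨g, hg⟩ := exists_maxClique_le hr h hM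
  have hup : (maxClique (rPartitePatterns r) M : ℝ) ≤
      (M ∩ rainbow (blockColoring h g)).card + r * (n / K + 1 : ℕ) := by
    exact_mod_cast hg
  have hF : (rainbow (blockColoring h g)).card * (n / (r * n).choose r : ℝ) ≤ β * n := by
    rw [← e]
    refine mul_le_mul_of_nonneg_right ?_ (by positivity)
    exact_mod_cast card_rainbow_le hr (blockColoring h g)
  have h2g := abs_lt.1 (h2 g)
  have h1' := abs_lt.1 h1
  have hα' := abs_lt.1 hα
  have a1 : β * n ≤ (α + δ) * n := mul_le_mul_of_nonneg_right (by linarith) hn0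
  have a2 : (α - δ) * n ≤ β * n := mul_le_mul_of_nonneg_right (by linarith) hn0
  have hδ : 0 ≤ δ * n := mul_nonneg ((abs_nonneg _).trans hα.le) hn0
  -- Upper bound: `δ` from the limit of the mean, `δ` from the deviation and `2 * δ` from the block
  -- approximation. The lower bound needs only the first two.
  rw [abs_le]
  constructor <;> nlinarith

/-- Stated for any `X` agreeing with the clique number, so that it serves both asymptotic claims.
The union bound runs over `r ^ (r * K) + 1` colorings with `K` fixed, so a failure probability
tending to `0` for each suffices. -/
theorem asympInProb_of_eq_maxClique (hr : r ≠ 0)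
    {X : ∀ n : ℕ, Finset (Finset (Fin (r * n))) → ℝ}
    (hX : ∀ n, 1 ≤ n → ∀ M ∈ matchings r n, X n M = maxClique (rPartitePatterns r) M) :
    AsympInProb r X fun n => ((r - 1).factorial : ℝ) / (r : ℝ) ^ (r - 1) * (n : ℝ) := by
  intro ε hε
  have hr' : (0 : ℝ) < r := by exact_mod_cast Nat.pos_of_ne_zero hr
  have hβ := tendsto_pow_div_choose hr
  set α : ℝ := ((r - 1).factorial : ℝ) / (r : ℝ) ^ (r - 1) with hαdef
  have hα : 0 < α := by positivity
  obtain ⟨δ, hδ, hδε⟩ : ∃ δ, 0 < δ ∧ 4 * δ < ε * α := ⟨ε * α / 8, by positivity, by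
    have : 0 < ε * α := by positivity
    linarith⟩
  -- This gives `r * n / K ≤ δ * n`; the rounding `+ 1` in the block length costs `r ≤ δ * n` more,
  -- once `n ≥ r / δ`.
  obtain ⟨K, hK⟩ := exists_nat_gt (r / δ)
  have hK0 : (0 : ℝ) < K := (by positivity : (0 : ℝ) < r / δ).trans hK
  have hK0' : 0 < K := by exact_mod_cast hK0
  have hdiv : ∀ n, r * n ≤ (n / K + 1) * (r * K) := by
    intro n
    have : n ≤ (n / K + 1) * K := by
      have h1 := Nat.div_add_mod n K
      have h2 := Nat.mod_lt n hK0'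
      nlinarith
    nlinarith
  -- `none` stands for the balanced coloring of the lower bound, `some g` for the block colorings of
  -- the upper bound.
  let F : ∀ n, Option (Fin (r * K) → Fin r) → Finset (Finset (Fin (r * n))) := fun n o =>
    o.elim (rainbow Fin.divNat) fun g => rainbow (blockColoring (hdiv n) g)
  have hF : ∀ n o, ∀ e ∈ F n o, e.card = r := by
    rintro n (_ | g) e he
    · exact (mem_rainbow.1 he).1
    · exact (mem_rainbow.1 he).1
  have hlim : Tendsto (fun n => 1 - (Fintype.card (Option (Fin (r * K) → Fin r)) : ℝ) *
      (varianceBound r n / δ ^ 2)) atTop (𝓝 1) := by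
    have := (((tendsto_varianceBound hr).div_const (δ ^ 2)).const_mul
      (Fintype.card (Option (Fin (r * K) → Fin r)) : ℝ)).const_sub 1
    simpa using this
  refine tendsto_of_tendsto_of_tendsto_of_le_of_le' hlim tendsto_const_nhds ?_
    (Eventually.of_forall fun n => probRM_le_one _)
  filter_upwards [eventually_ge_atTop 2, (Metric.tendsto_nhds.1 hβ) δ hδ,
    eventually_ge_atTop ⌈r / δ⌉₊] with n hn hnβ hnδ
  have hn0 : (0 : ℝ) < n := by exact_mod_cast (by omega : 0 < n)
  have hnδ' : (r : ℝ) ≤ δ * n := by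
    have := (div_le_iff₀ hδ).1 (Nat.ceil_le.1 hnδ)
    linarith
  have hL : (r * (n / K + 1 : ℕ) : ℝ) ≤ 2 * δ * n := by
    have h1 : ((n / K : ℕ) : ℝ) ≤ n / K := Nat.cast_div_le
    have h2 : (r : ℝ) * (n / K) ≤ δ * n := by
      rw [← mul_div_assoc, div_le_iff₀ hK0]
      have := (div_lt_iff₀ hδ).1 hK
      nlinarith
    have h3 := mul_le_mul_of_nonneg_left h1 hr'.le
    push_cast
    linarith
  have hsum : ∑ o, probRM r n (fun M => δ * n ≤
      |(M ∩ F n o).card - (F n o).card * (n / (r * n).choose r : ℝ)|) ≤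
      (Fintype.card (Option (Fin (r * K) → Fin r)) : ℝ) * (varianceBound r n / δ ^ 2) := by
    rw [← nsmul_eq_mul]
    exact Finset.sum_le_card_nsmul _ _ _ fun o _ => probRM_deviation_le hr hn (hF n o) hδ
  refine (sub_le_sub_left hsum 1).trans (one_sub_sum_probRM_le hr Finset.univ ?_)
  intro M hM hq
  have hq' := fun o => not_le.1 (hq o (Finset.mem_univ o))
  have key := abs_maxClique_sub_lt hr (hdiv n) (mem_matchings.1 hM).1
    (by rwa [Real.dist_eq] at hnβ) hL (hq' none) fun g => hq' (some g)
  rw [hX n (by omega) M hM]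
  have hαn : 0 < α * n := by positivity
  rw [div_sub_one hαn.ne', abs_div, abs_of_pos hαn, div_lt_iff₀ hαn]
  nlinarith

end Probability

end OrderedMatching

theorem mainTheorem2 (r : ℕ) (hr : 2 ≤ r) :
    -- the largest clique for the set of `r`-partite patterns
    OrderedMatching.AsympInProb r
      (fun _ M => (OrderedMatching.maxClique (OrderedMatching.rPartitePatterns r) M : ℝ))
      (fun n => ((r - 1).factorial : ℝ) / (r : ℝ) ^ (r - 1) * (n : ℝ)) ∧
    -- its size is the size of a largest `r`-partite sub-matching
    (∀ n : ℕ, 1 ≤ n → ∀ M ∈ OrderedMatching.matchings r n,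
      (∃ N, OrderedMatching.IsLargestRPartite r M N) ∧
      ∀ N, OrderedMatching.IsLargestRPartite r M N →
        OrderedMatching.maxClique (OrderedMatching.rPartitePatterns r) M = N.card) ∧
    -- the same asymptotics for a largest `r`-partite sub-matching, however ties are broken
    (∀ R : ∀ n : ℕ, Finset (Finset (Fin (r * n))) → Finset (Finset (Fin (r * n))),
      (∀ n : ℕ, 1 ≤ n → ∀ M ∈ OrderedMatching.matchings r n,
        OrderedMatching.IsLargestRPartite r M (R n M)) →
      OrderedMatching.AsympInProb r (fun n M => ((R n M).card : ℝ))
        (fun n => ((r - 1).factorial : ℝ) / (r : ℝ) ^ (r - 1) * (n : ℝ))) := by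
  have hr0 : r ≠ 0 := by omega
  have hiff : ∀ n : ℕ, 1 ≤ n → ∀ M ∈ OrderedMatching.matchings r n, ∀ N,
      OrderedMatching.IsLargestRPartite r M N ↔
        N ⊆ M ∧ OrderedMatching.IsClique (OrderedMatching.rPartitePatterns r) N ∧
          N.card = OrderedMatching.maxClique (OrderedMatching.rPartitePatterns r) M := by
    intro n hn M hM N
    have h := OrderedMatching.mem_matchings.1 hM
    exact OrderedMatching.isLargestRPartite_iff hr0 h.1 (Finset.card_pos.1 (by omega))
  refine ⟨OrderedMatching.asympInProb_of_eq_maxClique hr0 fun _ _ _ _ => rfl,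
    fun n hn M hM => ⟨?_, fun N hN => (((hiff n hn M hM N).1 hN).2.2).symm⟩, fun R hR =>
    OrderedMatching.asympInProb_of_eq_maxClique hr0 fun n hn M hM => ?_⟩
  · obtain ⟨N, h⟩ := OrderedMatching.exists_isClique_card_eq_maxClique
      (OrderedMatching.rPartitePatterns r) M
    exact ⟨N, (hiff n hn M hM N).2 h⟩
  · rw [((hiff n hn M hM _).1 (hR n hn M hM)).2.2]
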